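/- For a set $A \subseteq \mathbb{N}$ let $A' = \{e : \Phi_e^A(e)\downarrow\}$ denote its Turing jump and, if $A$ is infinite, let $p_A$ denote its principal function, so that $p_A(n)$ is the $n$-th element of $A$ in increasing order. Say that $g : \mathbb{N} \to \mathbb{N}$ dominates $f : \mathbb{N} \to \mathbb{N}$ if $f(n) \le g(n)$ for all but finitely many $n$. There exist a set $L \subseteq \mathbb{N}$ and an infinite set $G \subseteq \mathbb{N}$ such that $p_G$ dominates every $L$-computable function $f : \mathbb{N} \to \mathbb{N}$, but $L'' \nleq_T G'$. (In other words, the implication "if $p_G$ dominates every $L$-computable function, then $G' \geq_T L''$" fails for some $L$ and $G$.) -/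

import Mathlib

open scoped Computability

namespace HighDom

open Classical in
/-- The characteristic function of a set of natural numbers, in the form in which Mathlib's
relative computability takes its oracles. -/
noncomputable def chi (A : Set ℕ) : ℕ →. ℕ :=
  fun n => Part.some (if n ∈ A then 1 else 0)

/-- `SetReducible A B` : the set `A` is Turing reducible to the set `B`. -/
def SetReducible (A B : Set ℕ) : Prop :=
  chi A ≤ᵀ chi B

/-- Programs for oracle computations; the constructors are the closure conditions of
`Nat.RecursiveIn`, with `oracle` for a query. -/
inductive OracleCode : Type
  | zero : OracleCode
  | succ : OracleCode
  | left : OracleCode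
  | right : OracleCode
  | oracle : OracleCode
  | pair : OracleCode → OracleCode → OracleCode
  | comp : OracleCode → OracleCode → OracleCode
  | prec : OracleCode → OracleCode → OracleCode
  | rfind : OracleCode → OracleCode

namespace OracleCode

/-- The partial function computed by a program with oracle `g`. -/
def eval (g : ℕ →. ℕ) : OracleCode → ℕ →. ℕ
  | zero => fun _ => Part.some 0
  | succ => fun n => Part.some (n + 1)
  | left => fun n => Part.some (Nat.unpair n).1
  | right => fun n => Part.some (Nat.unpair n).2
  | oracle => g
  | pair c d => fun n => Nat.pair <$> eval g c n <*> eval g d n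
  | comp c d => fun n => eval g d n >>= eval g c
  | prec c d => fun p =>
      let (a, n) := Nat.unpair p
      n.rec (eval g c a) fun y IH => do
        let i ← IH
        eval g d (Nat.pair a (Nat.pair y i))
  | rfind c => fun a => Nat.rfind fun n => (fun m => m = 0) <$> eval g c (Nat.pair a n)

/-- The Gödel number of a program. -/
def encode : OracleCode → ℕ
  | zero => 0
  | succ => 1
  | left => 2
  | right => 3
  | oracle => 4
  | pair c d => 4 * Nat.pair (encode c) (encode d) + 5
  | comp c d => 4 * Nat.pair (encode c) (encode d) + 6
  | prec c d => 4 * Nat.pair (encode c) (encode d) + 7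
  | rfind c => 4 * encode c + 8

/-- The program with a given Gödel number. -/
def ofNat : ℕ → OracleCode
  | 0 => zero
  | 1 => succ
  | 2 => left
  | 3 => right
  | 4 => oracle
  | n + 5 =>
    have _h : n / 4 < n + 5 := by omega
    have _h1 : (n / 4).unpair.1 < n + 5 := lt_of_le_of_lt (n / 4).unpair_left_le _h
    have _h2 : (n / 4).unpair.2 < n + 5 := lt_of_le_of_lt (n / 4).unpair_right_le _h
    match n % 4 with
    | 0 => pair (ofNat (n / 4).unpair.1) (ofNat (n / 4).unpair.2)
    | 1 => comp (ofNat (n / 4).unpair.1) (ofNat (n / 4).unpair.2)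
    | 2 => prec (ofNat (n / 4).unpair.1) (ofNat (n / 4).unpair.2)
    | _ => rfind (ofNat (n / 4))

theorem ofNat_encode (c : OracleCode) : ofNat (encode c) = c := by
  induction c with
  | zero | succ | left | right | oracle => simp [encode, ofNat]
  | pair c d hc hd =>
    have h1 : (4 * Nat.pair (encode c) (encode d)) / 4 = Nat.pair (encode c) (encode d) := by omega
    have h2 : (4 * Nat.pair (encode c) (encode d)) % 4 = 0 := by omega
    rw [encode, ofNat, h1, h2]
    simp [hc, hd]
  | comp c d hc hd =>
    have h1 : (4 * Nat.pair (encode c) (encode d) + 1) / 4 = Nat.pair (encode c) (encode d) := by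
      omega
    have h2 : (4 * Nat.pair (encode c) (encode d) + 1) % 4 = 1 := by omega
    rw [encode, ofNat, h1, h2]
    simp [hc, hd]
  | prec c d hc hd =>
    have h1 : (4 * Nat.pair (encode c) (encode d) + 2) / 4 = Nat.pair (encode c) (encode d) := by
      omega
    have h2 : (4 * Nat.pair (encode c) (encode d) + 2) % 4 = 2 := by omega
    rw [encode, ofNat, h1, h2]
    simp [hc, hd]
  | rfind c hc =>
    have h1 : (4 * encode c + 3) / 4 = encode c := by omega
    have h2 : (4 * encode c + 3) % 4 = 3 := by omega
    rw [encode, ofNat, h1, h2]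
    simp [hc]

end OracleCode

/-- `Phi A e` is the `e`-th partial function computable with oracle `A`. -/
noncomputable def Phi (A : Set ℕ) (e : ℕ) : ℕ →. ℕ :=
  (OracleCode.ofNat e).eval (chi A)

/-- The functions `Phi A e` are exactly the partial functions recursive in `A`. -/
theorem recursiveIn_iff_exists_Phi (A : Set ℕ) (f : ℕ →. ℕ) :
    RecursiveIn {chi A} f ↔ ∃ e, Phi A e = f := by
  rw [RecursiveIn.iff_nat]
  constructor
  · intro h
    suffices ∃ c : OracleCode, c.eval (chi A) = f by
      obtain ⟨c, hc⟩ := this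
      exact ⟨c.encode, by rw [Phi, OracleCode.ofNat_encode, hc]⟩
    induction h with
    | zero => exact ⟨.zero, rfl⟩
    | succ => exact ⟨.succ, rfl⟩
    | left => exact ⟨.left, rfl⟩
    | right => exact ⟨.right, rfl⟩
    | oracle g hg => exact ⟨.oracle, hg.symm⟩
    | pair _ _ h1 h2 =>
      obtain ⟨c, rfl⟩ := h1
      obtain ⟨d, rfl⟩ := h2
      exact ⟨.pair c d, rfl⟩
    | comp _ _ h1 h2 =>
      obtain ⟨c, rfl⟩ := h1
      obtain ⟨d, rfl⟩ := h2
      exact ⟨.comp c d, rfl⟩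
    | prec _ _ h1 h2 =>
      obtain ⟨c, rfl⟩ := h1
      obtain ⟨d, rfl⟩ := h2
      exact ⟨.prec c d, rfl⟩
    | rfind _ h1 =>
      obtain ⟨c, rfl⟩ := h1
      exact ⟨.rfind c, rfl⟩
  · rintro ⟨e, rfl⟩
    rw [Phi]
    generalize OracleCode.ofNat e = c
    induction c with
    | zero => exact .zero
    | succ => exact .succ
    | left => exact .left
    | right => exact .right
    | oracle => exact .oracle _ rfl
    | pair c d hc hd => exact .pair hc hd
    | comp c d hc hd => exact .comp hc hd
    | prec c d hc hd => exact .prec hc hd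
    | rfind c hc => exact .rfind hc

/-- The Turing jump `A' = {e : Φ_e^A(e) is defined}`. -/
def jump (A : Set ℕ) : Set ℕ :=
  {e | (Phi A e e).Dom}

/-- The principal function of an infinite set: its `n`-th element in increasing order
(counting from `0`). -/
noncomputable def principalFunction (A : Set ℕ) : ℕ → ℕ :=
  Nat.nth (· ∈ A)

/-- `g` dominates `f`. -/
def Dominates (g f : ℕ → ℕ) : Prop :=
  ∀ᶠ n in Filter.atTop, f n ≤ g n

end HighDom

open MeasureTheory Filter Topology

namespace HighDom

namespace OracleCode

/-! The argument is measure-theoretic and needs no effectivity. Let `L` be the lower cut of a random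
real in `[0, 1]`. For each index `e`, Borel–Cantelli yields one function eventually bounding `Phi L
e` wherever defined, for almost every `L`. There are countably many indices, so a single strictly
increasing `g` dominates all `L`-computable functions for almost every `L`
(`exists_strictMono_ae_dominates`). Take `G = Set.range g`, so that `p_G = g`. Only countably many
sets are reducible to `G'`, and the double jump is injective, so `L'' ≤ G'` holds for countably many
reals, a null set. Almost every `L` therefore works. -/

theorem eval_pair (g : ℕ →. ℕ) (c d : OracleCode) (n : ℕ) :
    (pair c d).eval g n = (c.eval g n).bind fun a => (d.eval g n).map (Nat.pair a) := by
  change ((c.eval g n).map Nat.pair).bind (fun f => (d.eval g n).map f) = _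
  rw [Part.bind_map]

theorem eval_comp (g : ℕ →. ℕ) (c d : OracleCode) (n : ℕ) :
    (comp c d).eval g n = (d.eval g n).bind fun a => c.eval g a := rfl

theorem eval_prec_zero (g : ℕ →. ℕ) (c d : OracleCode) (a : ℕ) :
    (prec c d).eval g (Nat.pair a 0) = c.eval g a := by
  simp only [eval, Nat.unpair_pair]
  rfl

theorem eval_prec_succ (g : ℕ →. ℕ) (c d : OracleCode) (a n : ℕ) :
    (prec c d).eval g (Nat.pair a (n + 1)) =
      ((prec c d).eval g (Nat.pair a n)).bind fun i => d.eval g (Nat.pair a (Nat.pair n i)) := by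
  simp only [eval, Nat.unpair_pair]
  rfl

theorem mem_eval_rfind (g : ℕ →. ℕ) (c : OracleCode) (n y : ℕ) :
    y ∈ (rfind c).eval g n ↔
      0 ∈ c.eval g (Nat.pair n y) ∧ ∀ m < y, ∃ k, k + 1 ∈ c.eval g (Nat.pair n m) := by
  change y ∈ Nat.rfind (fun m => (c.eval g (Nat.pair n m)).map fun k => decide (k = 0)) ↔ _
  refine Nat.mem_rfind.trans (and_congr ?_ ?_)
  · refine (Part.mem_map_iff _).trans ⟨?_, fun h => ⟨0, h, by simp⟩⟩
    rintro ⟨k, hk, h⟩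
    rwa [of_decide_eq_true h] at hk
  · refine forall₂_congr fun m _ => (Part.mem_map_iff _).trans ⟨?_, fun ⟨k, hk⟩ => ⟨k + 1, hk, by simp⟩⟩
    rintro ⟨k, hk, h⟩
    obtain ⟨l, rfl⟩ := Nat.exists_eq_succ_of_ne_zero (of_decide_eq_false h)
    exact ⟨l, hk⟩

/-- A program with constant value `n`. -/
def const : ℕ → OracleCode
  | 0 => zero
  | n + 1 => comp succ (const n)

theorem eval_const (g : ℕ →. ℕ) (n x : ℕ) : (const n).eval g x = Part.some n := by
  induction n with
  | zero => rfl
  | succ n ih =>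
    rw [const, eval_comp, ih, Part.bind_some]
    rfl

/-- A program that, with oracle `chi A`, maps `x` to `0` if the left component of `x` is in `A`,
and to `1` otherwise. -/
def notMemLeft : OracleCode :=
  -- `prec succ zero` flips the oracle bit: it sends `(0, 0)` to `1` and `(0, 1)` to `0`.
  comp (prec succ zero) (pair zero (comp oracle left))

theorem eval_notMemLeft (A : Set ℕ) [DecidablePred (· ∈ A)] (x : ℕ) :
    notMemLeft.eval (chi A) x = Part.some (if x.unpair.1 ∈ A then 0 else 1) := by
  have hl : (comp oracle left).eval (chi A) x = Part.some (if x.unpair.1 ∈ A then 1 else 0) := by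
    rw [eval_comp]
    refine (Part.bind_some _ _).trans ?_
    simp only [eval, chi]
    congr
  have hz (y : ℕ) : zero.eval (chi A) y = Part.some 0 := rfl
  have hs (y : ℕ) : succ.eval (chi A) y = Part.some (y + 1) := rfl
  rw [notMemLeft, eval_comp, eval_pair, hl, hz, Part.bind_some, Part.map_some, Part.bind_some]
  by_cases h : x.unpair.1 ∈ A
  · rw [if_pos h, if_pos h, eval_prec_succ, eval_prec_zero, hs, Part.bind_some, hz]
  · rw [if_neg h, if_neg h, eval_prec_zero, hs]

/-- A program that, with oracle `chi A`, halts on some (every) input if and only if `n ∈ A`. -/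
def haltIfMem (n : ℕ) : OracleCode :=
  -- The test ignores the search variable, so the search stops at `0` or never.
  comp (rfind notMemLeft) (const n)

theorem eval_haltIfMem_dom (A : Set ℕ) (n x : ℕ) :
    ((haltIfMem n).eval (chi A) x).Dom ↔ n ∈ A := by
  classical
  rw [haltIfMem, eval_comp, eval_const, Part.bind_some, Part.dom_iff_mem]
  simp only [mem_eval_rfind, eval_notMemLeft, Nat.unpair_pair, Part.mem_some_iff]
  by_cases h : n ∈ A
  · simpa [h] using ⟨0, Nat.zero_le⟩
  · simp [h]

/-- If the oracle depends measurably on a parameter, then so does the outcome of a program. -/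
theorem measurableSet_mem_eval {α : Type*} [MeasurableSpace α] {g : α → ℕ →. ℕ}
    (hg : ∀ n y, MeasurableSet {x | y ∈ g x n}) (c : OracleCode) (n y : ℕ) :
    MeasurableSet {x | y ∈ c.eval (g x) n} := by
  induction c generalizing n y with
  | zero => exact .const (y ∈ Part.some 0)
  | succ => exact .const (y ∈ Part.some (n + 1))
  | left => exact .const (y ∈ Part.some n.unpair.1)
  | right => exact .const (y ∈ Part.some n.unpair.2)
  | oracle => exact hg n y
  | pair c d hc hd =>
    have : {x | y ∈ (c.pair d).eval (g x) n} = ⋃ a, ⋃ b, ⋃ _ : Nat.pair a b = y,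
        {x | a ∈ c.eval (g x) n} ∩ {x | b ∈ d.eval (g x) n} := by
      ext x
      simp only [eval_pair, Part.mem_bind_iff, Part.mem_map_iff, Set.mem_ofPred_eq, Set.mem_iUnion,
        Set.mem_inter_iff]
      grind
    rw [this]
    exact .iUnion fun a => .iUnion fun b => .iUnion fun _ => (hc n a).inter (hd n b)
  | comp c d hc hd =>
    have : {x | y ∈ (c.comp d).eval (g x) n} =
        ⋃ a, {x | a ∈ d.eval (g x) n} ∩ {x | y ∈ c.eval (g x) a} := by
      ext x
      simp only [eval_comp, Part.mem_bind_iff, Set.mem_ofPred_eq, Set.mem_iUnion,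
        Set.mem_inter_iff]
    rw [this]
    exact .iUnion fun a => (hd n a).inter (hc a y)
  | prec c d hc hd =>
    rw [← Nat.pair_unpair n]
    generalize n.unpair.1 = a
    generalize n.unpair.2 = m
    induction m generalizing y with
    | zero => simpa only [eval_prec_zero] using hc a y
    | succ m ih =>
      have : {x | y ∈ (c.prec d).eval (g x) (Nat.pair a (m + 1))} =
          ⋃ i, {x | i ∈ (c.prec d).eval (g x) (Nat.pair a m)} ∩
            {x | y ∈ d.eval (g x) (Nat.pair a (Nat.pair m i))} := by
        ext x
        simp only [eval_prec_succ, Part.mem_bind_iff, Set.mem_ofPred_eq, Set.mem_iUnion,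
          Set.mem_inter_iff]
      rw [this]
      exact .iUnion fun i => (ih i).inter (hd _ y)
  | rfind c hc =>
    have : {x | y ∈ (rfind c).eval (g x) n} =
        {x | 0 ∈ c.eval (g x) (Nat.pair n y)} ∩
          ⋂ m, ⋂ _ : m < y, ⋃ k, {x | k + 1 ∈ c.eval (g x) (Nat.pair n m)} := by
      ext x
      simp only [mem_eval_rfind, Set.mem_ofPred_eq, Set.mem_iUnion, Set.mem_iInter,
        Set.mem_inter_iff]
    rw [this]
    exact (hc _ 0).inter (.iInter fun m => .iInter fun _ => .iUnion fun k => hc _ (k + 1))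

end OracleCode

/-! ### Injectivity of the jump and countability of lower cones -/

theorem encode_haltIfMem_mem_jump (A : Set ℕ) (n : ℕ) :
    (OracleCode.haltIfMem n).encode ∈ jump A ↔ n ∈ A := by
  rw [jump, Set.mem_ofPred_eq, Phi, OracleCode.ofNat_encode, OracleCode.eval_haltIfMem_dom]

/-- `A` can be read off from its jump at the codes of the programs `haltIfMem n`. -/
theorem jump_injective : Function.Injective jump := by
  intro A B h
  ext n
  rw [← encode_haltIfMem_mem_jump A, h, encode_haltIfMem_mem_jump B]

theorem chi_injective : Function.Injective chi := by
  classical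
  intro A B h
  ext n
  have := congrFun h n
  by_cases hA : n ∈ A <;> by_cases hB : n ∈ B <;> simp_all [chi]

theorem countable_setReducible (B : Set ℕ) : {A | SetReducible A B}.Countable := by
  refine Set.Countable.mono ?_ ((Set.countable_range (Phi B)).preimage chi_injective)
  exact fun A hA => (recursiveIn_iff_exists_Phi B _).1 hA

theorem exists_Phi_eq_some {A : Set ℕ} {f : ℕ → ℕ} (hf : ComputableIn {chi A} f) :
    ∃ e, ∀ n, Phi A e n = Part.some (f n) := by
  obtain ⟨e, he⟩ := (recursiveIn_iff_exists_Phi A _).1 hf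
  exact ⟨e, fun n => congrFun he n⟩

/-! ### Dominating functions -/

theorem exists_strictMono_dominates (h : ℕ → ℕ → ℕ) :
    ∃ g : ℕ → ℕ, StrictMono g ∧ ∀ e, Dominates g (h e) := by
  let s : ℕ → ℕ := fun m => ∑ e ∈ Finset.range (m + 1), h e m
  refine ⟨fun n => n + ∑ m ∈ Finset.range (n + 1), s m, strictMono_nat_of_lt_succ fun n => ?_,
    fun e => ?_⟩
  · simp only [Finset.sum_range_succ _ (n + 1)]
    omega
  · filter_upwards [eventually_ge_atTop e] with n hn
    calc h e n ≤ s n := Finset.single_le_sum (f := fun e => h e n) (fun _ _ => Nat.zero_le _)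
          (Finset.mem_range.2 (by omega))
      _ ≤ ∑ m ∈ Finset.range (n + 1), s m :=
          Finset.single_le_sum (fun _ _ => Nat.zero_le _) (Finset.self_mem_range_succ n)
      _ ≤ _ := Nat.le_add_left _ _

theorem principalFunction_range {g : ℕ → ℕ} (hg : StrictMono g) :
    principalFunction (Set.range g) = g := by
  have hinf : (Set.range g).Infinite := Set.infinite_range_of_injective hg.injective
  exact ((Nat.nth_strictMono hinf).range_inj hg).1 (Nat.range_nth_of_infinite hinf)

/-- A measurable family of partial functions on a finite measure space is almost everywhere
eventually bounded by a single function. -/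
theorem exists_ae_eventually_le {α : Type*} [MeasurableSpace α] (μ : Measure α)
    [IsFiniteMeasure μ] (F : α → ℕ →. ℕ) (hF : ∀ n y, MeasurableSet {x | y ∈ F x n}) :
    ∃ h : ℕ → ℕ, ∀ᵐ x ∂μ, ∀ᶠ n in atTop, ∀ y ∈ F x n, y ≤ h n := by
  -- The event that `F x n` converges to a value above `k`. It shrinks to `∅` as `k` grows,
  -- divergence being excluded, so its measure tends to `0`.
  let s : ℕ → ℕ → Set α := fun n k => ⋃ y, ⋃ _ : k < y, {x | y ∈ F x n}
  have mem_s {n k x} : x ∈ s n k ↔ ∃ y ∈ F x n, k < y := by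
    simp only [s, Set.mem_iUnion, Set.mem_ofPred_eq, exists_prop, and_comm]
  have hs (n k) : MeasurableSet (s n k) := .iUnion fun y => .iUnion fun _ => hF n y
  have hanti (n) : Antitone (s n) := fun k l hkl x hx => by
    obtain ⟨y, hy, hl⟩ := mem_s.1 hx
    exact mem_s.2 ⟨y, hy, hkl.trans_lt hl⟩
  have hempty (n) : ⋂ k, s n k = ∅ := by
    refine Set.eq_empty_of_forall_notMem fun x hx => ?_
    obtain ⟨y, hy, -⟩ := mem_s.1 (Set.mem_iInter.1 hx 0)
    obtain ⟨z, hz, hyz⟩ := mem_s.1 (Set.mem_iInter.1 hx y)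
    exact hyz.ne (Part.mem_unique hy hz)
  have hlim (n) : Tendsto (fun k => μ (s n k)) atTop (𝓝 0) := by
    simpa [hempty n, Function.comp_def] using tendsto_measure_iInter_atTop (μ := μ)
      (fun k => (hs n k).nullMeasurableSet) (hanti n) ⟨0, measure_ne_top _ _⟩
  obtain ⟨δ, hδ, hsum⟩ := ENNReal.exists_pos_sum_of_countable' (one_ne_zero (α := ENNReal)) ℕ
  -- The exceptional events for `h` have summable measure, as Borel–Cantelli requires.
  choose h hh using fun n => ((hlim n).eventually (gt_mem_nhds (hδ n))).exists
  refine ⟨h, ?_⟩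
  have hfin : ∑' n, μ (s n (h n)) ≠ ⊤ :=
    ((ENNReal.tsum_le_tsum fun n => (hh n).le).trans_lt (hsum.trans ENNReal.one_lt_top)).ne
  filter_upwards [ae_eventually_notMem hfin] with x hx
  filter_upwards [hx] with n hn y hy
  exact not_lt.1 fun hlt => hn (mem_s.2 ⟨y, hy, hlt⟩)

/-- For a measurable family of sets, some function dominates almost surely all functions that are
computable in the set. -/
theorem exists_strictMono_ae_dominates {α : Type*} [MeasurableSpace α] (μ : Measure α)
    [IsFiniteMeasure μ] (A : α → Set ℕ) (hA : ∀ n, MeasurableSet {x | n ∈ A x}) :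
    ∃ g : ℕ → ℕ, StrictMono g ∧
      ∀ᵐ x ∂μ, ∀ f : ℕ → ℕ, ComputableIn {chi (A x)} f → Dominates g f := by
  classical
  have hchi (n y) : MeasurableSet {x | y ∈ chi (A x) n} := by
    have : {x | y ∈ chi (A x) n} = {x | n ∈ A x}.ite {_x | y = 1} {_x | y = 0} := by
      ext x
      by_cases h : n ∈ A x <;> simp [chi, h, Set.ite]
    rw [this]
    exact (hA n).ite (.const _) (.const _)
  choose h hh using fun e => exists_ae_eventually_le μ (fun x => Phi (A x) e)
    (OracleCode.measurableSet_mem_eval hchi (OracleCode.ofNat e))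
  obtain ⟨g, hg, hgh⟩ := exists_strictMono_dominates h
  refine ⟨g, hg, ?_⟩
  filter_upwards [ae_all_iff.2 hh] with x hx f hf
  obtain ⟨e, he⟩ := exists_Phi_eq_some hf
  filter_upwards [hx e, hgh e] with n h1 h2
  exact (h1 (f n) (by rw [he n]; exact Part.mem_some _)).trans h2

/-- The set of indices of rational numbers below a real number. -/
def lowerCut (x : ℝ) : Set ℕ :=
  {n | ∃ q ∈ Encodable.decode (α := ℚ) n, (q : ℝ) < x}

theorem encode_mem_lowerCut {x : ℝ} {q : ℚ} : Encodable.encode q ∈ lowerCut x ↔ (q : ℝ) < x := by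
  simp [lowerCut]

theorem lowerCut_injective : Function.Injective lowerCut := by
  refine fun x y h => eq_of_forall_rat_lt_iff_lt fun q => ?_
  rw [← encode_mem_lowerCut, h, encode_mem_lowerCut]

theorem measurableSet_mem_lowerCut (n : ℕ) : MeasurableSet {x | n ∈ lowerCut x} := by
  have : {x | n ∈ lowerCut x} =
      ⋃ q : ℚ, ⋃ _ : q ∈ Encodable.decode (α := ℚ) n, Set.Ioi (q : ℝ) := by
    ext x
    simp [lowerCut]
  rw [this]
  exact .iUnion fun q => .iUnion fun _ => measurableSet_Ioi

end HighDom

theorem mainTheorem11 :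
    ∃ L G : Set ℕ, G.Infinite ∧
      (∀ f : ℕ → ℕ, ComputableIn {HighDom.chi L} f →
        HighDom.Dominates (HighDom.principalFunction G) f) ∧
      ¬ HighDom.SetReducible (HighDom.jump (HighDom.jump L)) (HighDom.jump G) := by
  let μ : Measure ℝ := volume.restrict (Set.Icc 0 1)
  obtain ⟨g, hg, hdom⟩ := HighDom.exists_strictMono_ae_dominates μ HighDom.lowerCut
    HighDom.measurableSet_mem_lowerCut
  have hcount : {x | HighDom.SetReducible (HighDom.jump (HighDom.jump (HighDom.lowerCut x)))
      (HighDom.jump (Set.range g))}.Countable :=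
    (HighDom.countable_setReducible (HighDom.jump (Set.range g))).preimage
      (HighDom.jump_injective.comp (HighDom.jump_injective.comp HighDom.lowerCut_injective))
  -- Nonzero mass turns "almost every" into existence.
  have : NeZero μ := ⟨by simp [μ]⟩
  obtain ⟨x, hx, hx'⟩ := (hdom.and (hcount.ae_notMem μ)).exists
  refine ⟨HighDom.lowerCut x, Set.range g, Set.infinite_range_of_injective hg.injective, ?_, hx'⟩
  rwa [HighDom.principalFunction_range hg]
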